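/- **Syntax.** Arities are finite sequences $(\alpha_1,\dots,\alpha_k)$ of arities; the order of $()$ is $0$ and the order of $(\alpha_1,\dots,\alpha_k)$ with $k\ge 1$ is $1+\max_i \mathrm{order}(\alpha_i)$. Every variable and every constant has an arity. The Church-typed lambda-free framework $\mathrm{TF}_{\mathrm k}$ has *objects* $z\vec F$ ($z$ an $\alpha$-ary variable or constant, $\vec F$ an $\alpha$-ary abstraction sequence), *$\alpha$-ary abstractions* $[\Delta]M$ ($\Delta$ an $\alpha$-ary context, $M$ an object), *$(\alpha_1,\dots,\alpha_k)$-ary abstraction sequences* $\langle F_1,\dots,F_k\rangle$ ($F_i$ an $\alpha_i$-ary abstraction), *$(\alpha_1,\dots,\alpha_k)$-ary contexts* $x_1:K_1,\dots,x_k:K_k$ ($x_i$ an $\alpha_i$-ary variable, $K_i$ an $\alpha_i$-ary kind), and *$\alpha$-ary kinds* $(\Delta)T$, where the base kind $T$ is $\mathbf{Type}$ or $\mathrm{El}(A)$, $A$ an object; all up to $\alpha$-conversion. The Curry-typed framework $\mathrm{TF}$ has the same syntax, except that abstractions are $[x_1,\dots,x_k]M$, without kind labels. The order of an expression is that of its arity.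 $|X|$ is the $\mathrm{TF}$-expression obtained from the $\mathrm{TF}_{\mathrm k}$-expression $X$ by erasing the kind labels in abstractions. Instantiation $\{F/x\}$ is hereditary substitution: for $z\ne x$, $\{F/x\}z[G_1,\dots,G_k]\equiv z[\{F/x\}G_1,\dots,\{F/x\}G_k]$, and if $F$ is $[t_1:K_1,\dots,t_k:K_k]P$ (or $[t_1,\dots,t_k]P$ in $\mathrm{TF}$), then $\{F/x\}x[G_1,\dots,G_k]\equiv\{\{F/x\}G_1/t_1\}\cdots\{\{F/x\}G_k/t_k\}P$. For $\Delta\equiv x_1:K_1,\dots,x_k:K_k$, $\{\vec F/\Delta\}X$ is $\{F_1/x_1\}\cdots\{F_k/x_k\}X$. **Judgements.** The primitive judgements of $\mathrm{TF}_{\mathrm k}$ are $\Gamma\ \mathrm{valid}$, $\Gamma\vdash M:T$ and $\Gamma\vdash M=N:T$ ($T$ a base kind). The following abbreviate finite sets of primitive judgements, and hold when all of these are derivable. - $\Gamma\Vdash(\Delta)\mathbf{Type}\ \mathrm{kind}$ is $\Gamma,\Delta\ \mathrm{valid}$; $\Gamma\Vdash(\Delta)\mathrm{El}(A)\ \mathrm{kind}$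 is $\Gamma,\Delta\vdash A:\mathbf{Type}$. - $\Gamma\Vdash\mathbf{Type}=\mathbf{Type}$ is $\Gamma\ \mathrm{valid}$; $\Gamma\Vdash\mathrm{El}(A)=\mathrm{El}(B)$ is $\Gamma\vdash A=B:\mathbf{Type}$; $\Gamma\Vdash\mathbf{Type}=\mathrm{El}(B)$ and $\Gamma\Vdash\mathrm{El}(A)=\mathbf{Type}$ never hold. - $\Gamma\Vdash\langle\rangle=\langle\rangle$ is $\Gamma\ \mathrm{valid}$; $\Gamma\Vdash(\Delta,x:K)=(\Delta',x:K')$ is $\Gamma\Vdash\Delta=\Delta'$ and $\Gamma,\Delta\Vdash K=K'$; $\Gamma\Vdash(\Delta)T=(\Delta')T'$ is $\Gamma\Vdash\Delta=\Delta'$ and $\Gamma,\Delta\Vdash T=T'$. - $\Gamma\Vdash[\Delta_1]M:(\Delta)T$ is $\Gamma\Vdash\Delta=\Delta_1$ and $\Gamma,\Delta\vdash M:T$; $\Gamma\Vdash[\Delta_1]M=[\Delta_2]N:(\Delta)T$ is $\Gamma\Vdash\Delta=\Delta_1$, $\Gamma\Vdash\Delta=\Delta_2$ and $\Gamma,\Delta\vdash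 M=N:T$. - $\Gamma\Vdash\langle\rangle::\langle\rangle$ is $\Gamma\ \mathrm{valid}$; $\Gamma\Vdash(\vec F,F_0)::(\Delta,x:K)$ is $\Gamma\Vdash\vec F::\Delta$ and $\Gamma\Vdash F_0:\{\vec F/\Delta\}K$. - $\Gamma\Vdash\langle\rangle=\langle\rangle::\langle\rangle$ is $\Gamma\ \mathrm{valid}$; $\Gamma\Vdash(\vec F,F_0)=(\vec G,G_0)::(\Delta,x:K)$ is $\Gamma\Vdash\vec F=\vec G::\Delta$ and $\Gamma\Vdash F_0=G_0:\{\vec F/\Delta\}K$. A *specification* $\mathcal T$ declares constants $c:K$ ($K$ a closed kind of the arity of $c$; each constant at most once) and equations $(\Delta)(M=N:T)$ ($\Delta$ a closed context, with $M,N,T$ having their free variables in its domain). The rules of deduction are: - $\langle\rangle\ \mathrm{valid}$; from $\Gamma\Vdash K\ \mathrm{kind}$ infer $\Gamma,x:K\ \mathrm{valid}$ ($x$ not in the domain of $\Gamma$); - for $z:(\Delta)T$ in $\Gamma$ or declared in $\mathcal T$: from $\Gamma\Vdash\vec F::\Delta$ infer $\Gamma\vdash z\vec F:\{\vec F/\Delta\}T$;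 from $\Gamma\Vdash\vec F=\vec G::\Delta$ infer $\Gamma\vdash z\vec F=z\vec G:\{\vec F/\Delta\}T$; - for an equation $(\Delta)(M=N:T)$ of $\mathcal T$: from $\Gamma\Vdash\vec F::\Delta$ infer $\Gamma\vdash\{\vec F/\Delta\}M=\{\vec F/\Delta\}N:\{\vec F/\Delta\}T$; - reflexivity (from $\Gamma\vdash M:T$ infer $\Gamma\vdash M=M:T$), symmetry and transitivity of equality; - conversion: from $\Gamma\vdash A=B:\mathbf{Type}$ and $\Gamma\vdash M:\mathrm{El}(A)$ (respectively $\Gamma\vdash M=N:\mathrm{El}(A)$) infer $\Gamma\vdash M:\mathrm{El}(B)$ (respectively $\Gamma\vdash M=N:\mathrm{El}(B)$). $\mathcal T$ is *$n$-good* if, for every $\Gamma$ of order at most $n$, $\Gamma\vdash M=N:T$ implies $\Gamma\vdash M:T$ and $\Gamma\vdash N:T$. **Labelling.** Relative to the specification $|\mathcal T|$ in $\mathrm{TF}$ (all declarations erased) and a $\mathrm{TF}$-context $\Gamma$, the partial map $\mathcal L$ from $\mathrm{TF}$ to $\mathrm{TF}_{\mathrm k}$ is given by the recursive equations $$\mathcal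 L_\Gamma(z\vec F)\equiv z[\mathcal L_\Gamma^{\Delta}(\vec F)]\quad(z:(\Delta)T\text{ in }\Gamma\text{ or declared in }|\mathcal T|),\qquad \mathcal L_\Gamma^{(\Delta)T}([\operatorname{dom}\Delta]M)\equiv[\mathcal L_\Gamma(\Delta)]\,\mathcal L_{\Gamma,\Delta}(M),$$ $$\mathcal L_\Gamma^{\langle\rangle}(\langle\rangle)\equiv\langle\rangle,\qquad \mathcal L_\Gamma^{\Delta,x:K}(\vec F,G)\equiv\mathcal L_\Gamma^\Delta(\vec F),\ \mathcal L_\Gamma^{\{\vec F/\Delta\}K}(G),$$ $$\mathcal L_\Gamma(\mathbf{Type})\equiv\mathbf{Type},\quad \mathcal L_\Gamma(\mathrm{El}(A))\equiv\mathrm{El}(\mathcal L_\Gamma(A)),\quad \mathcal L_\Gamma((\Delta)T)\equiv(\mathcal L_\Gamma(\Delta))\,\mathcal L_{\Gamma,\Delta}(T),$$ $$\mathcal L_\Gamma(\langle\rangle)\equiv\langle\rangle,\qquad \mathcal L_\Gamma(\Delta,x:K)\equiv\mathcal L_\Gamma(\Delta),\ x:\mathcal L_{\Gamma,\Delta}(K).$$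 It is defined at an argument precisely when the recursion terminates there, and is then single-valued. **Theorem.** Let $\mathcal T$ be an $n$-good specification in $\mathrm{TF}_{\mathrm k}$, and let $\Gamma,F,\vec F,K,\Delta$ have order at most $n$. In each of the following, if the hypothesis holds, then the value of $\mathcal L$ in the conclusion is defined and the conclusion holds (all judgements being those of $\mathrm{TF}_{\mathrm k}$ under $\mathcal T$). 1. If $\Gamma\vdash M:T$, then $\Gamma\vdash M=\mathcal L_{|\Gamma|}(|M|):T$. 2. If $\Gamma\Vdash F:K$, then $\Gamma\Vdash F=\mathcal L_{|\Gamma|}^{|K|}(|F|):K$. 3. If $\Gamma\Vdash\vec F::\Delta$, then $\Gamma\Vdash\vec F=\mathcal L_{|\Gamma|}^{|\Delta|}(|\vec F|)::\Delta$. 4. If $\Gamma\Vdash K\ \mathrm{kind}$, then $\Gamma\Vdash K=\mathcal L_{|\Gamma|}(|K|)$. 5. If $\Gamma,\Delta\ \mathrm{valid}$, then $\Gamma\Vdash\Delta=\mathcal L_{|\Gamma|}(|\Delta|)$. -/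

import Mathlib

/-!
The lambda-free logical frameworks `TF` (Curry-typed) and `TFk` (Church-typed), formalised
with intrinsically scoped de Bruijn syntax, so that expressions are identified up to
alpha-conversion and every symbol is applied to an abstraction sequence of its own arity.
-/

universe u

namespace TF

/-- Arities.  `nil` is the base arity `()`, and `snoc (α₁, …, αₙ) β` is `(α₁, …, αₙ, β)`. -/
inductive Arity : Type
  | nil : Arity
  | snoc : Arity → Arity → Arity

namespace Arity

/-- Concatenation of arities. -/
@[reducible] def append (α : Arity) : Arity → Arity
  | nil => α
  | snoc β γ => snoc (append α β) γ

/-- The order: `()` has order `0`, and `(α₁, …, αₙ)` has order `1 + max (order αᵢ)`. -/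
def order : Arity → ℕ
  | nil => 0
  | snoc α β => max (order α) (order β + 1)

end Arity

/-- `Var s α`: the `α`-ary variables of a scope `s` (the arities of the variables in scope,
the most recent one last). -/
inductive Var : Arity → Arity → Type
  | zero {s α : Arity} : Var (s.snoc α) α
  | succ {s α β : Arity} : Var s α → Var (s.snoc β) α

/-- `curry`: the syntax of `TF`; `church`: the syntax of `TFk`. -/
inductive Mode : Type
  | curry
  | church

mutual
/-- Objects `z F⃗`, with `z` an `α`-ary variable or constant, `F⃗` an `α`-ary abstraction
sequence.  `C α` is the type of the `α`-ary constants. -/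
inductive Obj (C : Arity → Type u) : Mode → Arity → Type u
  | var {m : Mode} {s α : Arity} : Var s α → Args C m s α → Obj C m s
  | const {m : Mode} {s α : Arity} : C α → Args C m s α → Obj C m s

/-- `α`-ary abstraction sequences. -/
inductive Args (C : Arity → Type u) : Mode → Arity → Arity → Type u
  | nil {m : Mode} {s : Arity} : Args C m s Arity.nil
  | snoc {m : Mode} {s α β : Arity} : Args C m s α → Abs C m s β → Args C m s (α.snoc β)

/-- `α`-ary abstractions: `[x⃗]M` in `TF`, `[Δ]M` in `TFk`. -/
inductive Abs (C : Arity → Type u) : Mode → Arity → Arity → Type u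
  | plain {s α : Arity} : Obj C Mode.curry (s.append α) → Abs C Mode.curry s α
  | labelled {s α : Arity} :
      Tel C Mode.church s α → Obj C Mode.church (s.append α) → Abs C Mode.church s α

/-- `α`-ary contexts `Δ = x₁ : K₁, …, xₙ : Kₙ` relative to an ambient scope `s`. -/
inductive Tel (C : Arity → Type u) : Mode → Arity → Arity → Type u
  | nil {m : Mode} {s : Arity} : Tel C m s Arity.nil
  | snoc {m : Mode} {s α β : Arity} :
      Tel C m s α → Kind C m (s.append α) β → Tel C m s (α.snoc β)

/-- `α`-ary kinds `(Δ)T`. -/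
inductive Kind (C : Arity → Type u) : Mode → Arity → Arity → Type u
  | mk {m : Mode} {s α : Arity} : Tel C m s α → Base C m (s.append α) → Kind C m s α

/-- Base kinds `Type` and `El A`. -/
inductive Base (C : Arity → Type u) : Mode → Arity → Type u
  | type {m : Mode} {s : Arity} : Base C m s
  | el {m : Mode} {s : Arity} : Obj C m s → Base C m s
end

/-- Contexts, whose scope is their arity. -/
inductive Ctx (C : Arity → Type u) (m : Mode) : Arity → Type u
  | nil : Ctx C m Arity.nil
  | snoc {γ α : Arity} : Ctx C m γ → Kind C m γ α → Ctx C m (γ.snoc α)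

section Renaming

/-- Renamings of variables. -/
abbrev Ren (s t : Arity) : Type := ∀ ⦃α : Arity⦄, Var s α → Var t α

/-- Extension of a renaming by one bound variable. -/
def Ren.lift1 {s t : Arity} (r : Ren s t) (β : Arity) : Ren (s.snoc β) (t.snoc β)
  | _, .zero => .zero
  | _, .succ x => .succ (r x)

/-- Extension of a renaming by a sequence of bound variables. -/
def Ren.lift {s t : Arity} (r : Ren s t) : (β : Arity) → Ren (s.append β) (t.append β)
  | .nil => r
  | .snoc β γ => (Ren.lift r β).lift1 γ

/-- The inclusion of the scope `s` in `s, β⃗`. -/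
def Ren.wk {s : Arity} : (β : Arity) → Ren s (s.append β)
  | .nil => fun _ x => x
  | .snoc β _ => fun _ x => .succ (Ren.wk β x)

/-- The inclusion of the empty scope. -/
def Ren.empty (s : Arity) : Ren Arity.nil s := fun _ x => nomatch x

variable {C : Arity → Type u}

mutual
def Obj.rename {m : Mode} {s t : Arity} : Obj C m s → Ren s t → Obj C m t
  | .var x F, r => .var (r x) (F.rename r)
  | .const c F, r => .const c (F.rename r)

def Args.rename {m : Mode} {s t α : Arity} : Args C m s α → Ren s t → Args C m t α
  | .nil, _ => .nil
  | .snoc F G, r => .snoc (F.rename r) (G.rename r)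

def Abs.rename {m : Mode} {s t α : Arity} : Abs C m s α → Ren s t → Abs C m t α
  | .plain M, r => .plain (M.rename (r.lift _))
  | .labelled D M, r => .labelled (D.rename r) (M.rename (r.lift _))

def Tel.rename {m : Mode} {s t α : Arity} : Tel C m s α → Ren s t → Tel C m t α
  | .nil, _ => .nil
  | .snoc D K, r => .snoc (D.rename r) (K.rename (r.lift _))

def Kind.rename {m : Mode} {s t α : Arity} : Kind C m s α → Ren s t → Kind C m t α
  | .mk D T, r => .mk (D.rename r) (T.rename (r.lift _))

def Base.rename {m : Mode} {s t : Arity} : Base C m s → Ren s t → Base C m t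
  | .type, _ => .type
  | .el A, r => .el (A.rename r)
end

end Renaming

section Instantiation

/-- `Ins α s' s`: the scope `s'` is `s` with one `α`-ary variable inserted at some place. -/
inductive Ins (α : Arity) : Arity → Arity → Type
  | here {s : Arity} : Ins α (s.snoc α) s
  | there {s' s β : Arity} : Ins α s' s → Ins α (s'.snoc β) (s.snoc β)

/-- The same place, under further bound variables. -/
def Ins.lift {α s' s : Arity} (i : Ins α s' s) :
    (β : Arity) → Ins α (s'.append β) (s.append β)
  | .nil => i
  | .snoc β _ => .there (Ins.lift i β)

/-- The result of comparing a variable with the inserted one: either it is the inserted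
variable, or it is a variable of the remaining scope. -/
inductive Hit (α s : Arity) : Arity → Type
  | hit : Hit α s α
  | miss {β : Arity} : Var s β → Hit α s β

def Hit.succ {α s β γ : Arity} : Hit α s β → Hit α (s.snoc γ) β
  | .hit => .hit
  | .miss x => .miss (.succ x)

def Ins.look {α s' s : Arity} : Ins α s' s → {β : Arity} → Var s' β → Hit α s β
  | .here, _, .zero => .hit
  | .here, _, .succ y => .miss y
  | .there _, _, .zero => .miss .zero
  | .there i, _, .succ y => (i.look y).succ

variable {C : Arity → Type u}

/-- The object `M` of an abstraction `[x⃗]M` or `[Δ]M`. -/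
def Abs.body {m : Mode} {s α : Arity} : Abs C m s α → Obj C m (s.append α)
  | .plain M => M
  | .labelled _ M => M

/-- How to compute `{G₁/t₁}⋯{Gₙ/tₙ}P` when `⟨t₁, …, tₙ⟩` is an `α`-ary variable sequence. -/
abbrev Employ (C : Arity → Type u) (m : Mode) (α : Arity) : Type u :=
  ∀ ⦃s : Arity⦄, Args C m s α → Obj C m (s.append α) → Obj C m s

/-- The object obtained from `z G⃗`: `z G⃗` itself if `z` is not the instantiated variable,
and `{G₁/t₁}⋯{Gₙ/tₙ}P` if it is and `F = [t₁, …, tₙ]P` is the instantiating abstraction. -/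
def Hit.resolve {m : Mode} {α s β : Arity} (e : Employ C m α) (F : Abs C m s α) :
    Hit α s β → Args C m s β → Obj C m s
  | .hit, G => e G F.body
  | .miss y, G => .var y G

mutual
/-- Instantiation `{F/x}N`, by recursion on `N`, given the operation `e` to be used where
`x` itself is applied. -/
def Obj.instWith {m : Mode} {α s' s : Arity} :
    Obj C m s' → Employ C m α → Ins α s' s → Abs C m s α → Obj C m s
  | .var z G, e, i, F => (i.look z).resolve e F (G.instWith e i F)
  | .const c G, e, i, F => .const c (G.instWith e i F)
termination_by structural x => x

def Args.instWith {m : Mode} {α s' s β : Arity} :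
    Args C m s' β → Employ C m α → Ins α s' s → Abs C m s α → Args C m s β
  | .nil, _, _, _ => .nil
  | .snoc G H, e, i, F => .snoc (G.instWith e i F) (H.instWith e i F)
termination_by structural x => x

def Abs.instWith {m : Mode} {α s' s β : Arity} :
    Abs C m s' β → Employ C m α → Ins α s' s → Abs C m s α → Abs C m s β
  | .plain M, e, i, F => .plain (M.instWith e (i.lift _) (F.rename (Ren.wk _)))
  | .labelled D M, e, i, F =>
      .labelled (D.instWith e i F) (M.instWith e (i.lift _) (F.rename (Ren.wk _)))
termination_by structural x => x

def Tel.instWith {m : Mode} {α s' s β : Arity} :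
    Tel C m s' β → Employ C m α → Ins α s' s → Abs C m s α → Tel C m s β
  | .nil, _, _, _ => .nil
  | .snoc D K, e, i, F =>
      .snoc (D.instWith e i F) (K.instWith e (i.lift _) (F.rename (Ren.wk _)))
termination_by structural x => x

def Kind.instWith {m : Mode} {α s' s β : Arity} :
    Kind C m s' β → Employ C m α → Ins α s' s → Abs C m s α → Kind C m s β
  | .mk D T, e, i, F =>
      .mk (D.instWith e i F) (T.instWith e (i.lift _) (F.rename (Ren.wk _)))
termination_by structural x => x

def Base.instWith {m : Mode} {α s' s : Arity} :
    Base C m s' → Employ C m α → Ins α s' s → Abs C m s α → Base C m s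
  | .type, _, _, _ => .type
  | .el A, e, i, F => .el (A.instWith e i F)
termination_by structural x => x
end

/-- `{F₁/x₁}⋯{Fₙ/xₙ}M` for an `α`-ary abstraction sequence `F⃗`; together with
`Obj.instWith` this is hereditary instantiation, by recursion firstly on the arity and
secondly on the object. -/
def employ {m : Mode} : (α : Arity) → Employ C m α
  | .nil => fun _ _ M => M
  | .snoc α β => fun _ Fs M =>
      match Fs with
      | .snoc Fs F => employ α Fs (M.instWith (employ β) .here (F.rename (Ren.wk α)))

/-- Instantiation `{F/x}N` in objects; `i` marks the place of `x` in the scope. -/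
def Obj.inst {m : Mode} {α s' s : Arity} (i : Ins α s' s) (F : Abs C m s α)
    (N : Obj C m s') : Obj C m s :=
  N.instWith (employ α) i F

/-- Instantiation `{F/x}K` in kinds. -/
def Kind.inst {m : Mode} {α s' s β : Arity} (i : Ins α s' s) (F : Abs C m s α)
    (K : Kind C m s' β) : Kind C m s β :=
  K.instWith (employ α) i F

/-- Instantiation `{F/x}T` in base kinds. -/
def Base.inst {m : Mode} {α s' s : Arity} (i : Ins α s' s) (F : Abs C m s α)
    (T : Base C m s') : Base C m s :=
  T.instWith (employ α) i F

/-- `{F⃗/Δ}M = {F₁/x₁}⋯{Fₙ/xₙ}M`, where `⟨x₁, …, xₙ⟩` is the domain of `Δ`. -/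
def Obj.instSeq {m : Mode} {s α : Arity} : Args C m s α → Obj C m (s.append α) → Obj C m s
  | .nil, M => M
  | .snoc (α := α) Fs F, M => Obj.instSeq Fs (M.inst .here (F.rename (Ren.wk α)))

/-- `{F⃗/Δ}K`. -/
def Kind.instSeq {m : Mode} {s α β : Arity} :
    Args C m s α → Kind C m (s.append α) β → Kind C m s β
  | .nil, K => K
  | .snoc (α := α) Fs F, K => Kind.instSeq Fs (K.inst .here (F.rename (Ren.wk α)))

/-- `{F⃗/Δ}T`. -/
def Base.instSeq {m : Mode} {s α : Arity} :
    Args C m s α → Base C m (s.append α) → Base C m s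
  | .nil, T => T
  | .snoc (α := α) Fs F, T => Base.instSeq Fs (T.inst .here (F.rename (Ren.wk α)))

end Instantiation

section Judgements

variable {C : Arity → Type u} {m : Mode}

/-- The context `Γ, Δ`. -/
def Ctx.append {γ δ : Arity} (Γ : Ctx C m γ) : Tel C m γ δ → Ctx C m (γ.append δ)
  | .nil => Γ
  | .snoc D K => .snoc (Ctx.append Γ D) K

/-- The kind `K` with `x : K ∈ Γ`. -/
def Ctx.lookup {γ α : Arity} : Ctx C m γ → Var γ α → Kind C m γ α
  | .snoc _ K, .zero => K.rename (fun _ y => .succ y)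
  | .snoc Γ _, .succ x => (Ctx.lookup Γ x).rename (fun _ y => .succ y)

/-- The primitive judgements `Γ valid`, `Γ ⊢ M : T`, `Γ ⊢ M = N : T`.  The extra judgement
`undef`, which no rule derives, serves only to mark the defined judgements
`Γ ⊩ Type = El B` and `Γ ⊩ El A = Type`, which are left undefined. -/
inductive Jdg (C : Arity → Type u) (m : Mode) : Type u
  | valid {γ : Arity} (Γ : Ctx C m γ) : Jdg C m
  | typ {γ : Arity} (Γ : Ctx C m γ) (M : Obj C m γ) (T : Base C m γ) : Jdg C m
  | eq {γ : Arity} (Γ : Ctx C m γ) (M N : Obj C m γ) (T : Base C m γ) : Jdg C m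
  | undef : Jdg C m

/-! The defined judgement forms are sets of primitive judgements. -/

/-- `Γ ⊩ T kind`, for a base kind `T`. -/
def isBase {γ : Arity} (Γ : Ctx C m γ) : Base C m γ → Set (Jdg C m)
  | .type => {.valid Γ}
  | .el A => {.typ Γ A .type}

/-- `Γ ⊩ K kind`. -/
def isKind {γ α : Arity} (Γ : Ctx C m γ) : Kind C m γ α → Set (Jdg C m)
  | .mk D T => isBase (Γ.append D) T

/-- `Γ ⊩ T = T'`, for base kinds. -/
def eqBase {γ : Arity} (Γ : Ctx C m γ) : Base C m γ → Base C m γ → Set (Jdg C m)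
  | .type, .type => {.valid Γ}
  | .el A, .el B => {.eq Γ A B .type}
  | .type, .el _ => {.undef}
  | .el _, .type => {.undef}

mutual
/-- `Γ ⊩ Δ = Δ'`. -/
def eqTel {m : Mode} {γ δ : Arity} :
    Tel C m γ δ → Ctx C m γ → Tel C m γ δ → Set (Jdg C m)
  | .nil, Γ, .nil => {.valid Γ}
  | .snoc D K, Γ, .snoc D' K' => eqTel D Γ D' ∪ eqKind K (Γ.append D) K'

/-- `Γ ⊩ K = K'`. -/
def eqKind {m : Mode} {γ α : Arity} :
    Kind C m γ α → Ctx C m γ → Kind C m γ α → Set (Jdg C m)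
  | .mk D T, Γ, .mk D' T' => eqTel D Γ D' ∪ eqBase (Γ.append D) T T'
end

/-- `Γ ⊩ F : K`. -/
def absTyp {γ α : Arity} (Γ : Ctx C m γ) : Abs C m γ α → Kind C m γ α → Set (Jdg C m)
  | .plain M, .mk D T => {.typ (Γ.append D) M T}
  | .labelled D' M, .mk D T => eqTel D Γ D' ∪ {.typ (Γ.append D) M T}

/-- `Γ ⊩ F = G : K`. -/
def absEq {γ α : Arity} (Γ : Ctx C m γ) :
    Abs C m γ α → Abs C m γ α → Kind C m γ α → Set (Jdg C m)
  | .plain M, .plain N, .mk D T => {.eq (Γ.append D) M N T}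
  | .labelled D₁ M, .labelled D₂ N, .mk D T =>
      eqTel D Γ D₁ ∪ eqTel D Γ D₂ ∪ {.eq (Γ.append D) M N T}

/-- `Γ ⊩ F⃗ :: Δ`. -/
def seqTyp {γ δ : Arity} (Γ : Ctx C m γ) : Args C m γ δ → Tel C m γ δ → Set (Jdg C m)
  | .nil, .nil => {.valid Γ}
  | .snoc Fs F, .snoc D K => seqTyp Γ Fs D ∪ absTyp Γ F (K.instSeq Fs)

/-- `Γ ⊩ F⃗ = G⃗ :: Δ`. -/
def seqEq {γ δ : Arity} (Γ : Ctx C m γ) :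
    Args C m γ δ → Args C m γ δ → Tel C m γ δ → Set (Jdg C m)
  | .nil, .nil, .nil => {.valid Γ}
  | .snoc Fs F, .snoc Gs G, .snoc D K =>
      seqEq Γ Fs Gs D ∪ absEq Γ F G (K.instSeq Fs)

/-- Equation declarations `(Δ)(M = N : T)`. -/
structure EqDecl (C : Arity → Type u) (m : Mode) : Type u where
  arity : Arity
  ctx : Tel C m Arity.nil arity
  lhs : Obj C m (Arity.nil.append arity)
  rhs : Obj C m (Arity.nil.append arity)
  base : Base C m (Arity.nil.append arity)

/-- Type theory specifications: each constant is declared with at most one kind, of its own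
arity, and there is a set of equation declarations. -/
structure Spec (C : Arity → Type u) (m : Mode) : Type u where
  constKind : ∀ {α : Arity}, C α → Option (Kind C m Arity.nil α)
  eqns : Set (EqDecl C m)

/-- The rules of deduction (of `TF` or of `TFk`, according to the mode) under the
specification `S`. -/
inductive Spec.Derivable (S : Spec C m) : Jdg C m → Prop
  | emp_ctxt : S.Derivable (.valid .nil)
  | ctxt {γ α : Arity} {Γ : Ctx C m γ} {K : Kind C m γ α} :
      (∀ j ∈ isKind Γ K, S.Derivable j) → S.Derivable (.valid (.snoc Γ K))
  | var {γ δ : Arity} {Γ : Ctx C m γ} {x : Var γ δ} {D : Tel C m γ δ}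
      {T : Base C m (γ.append δ)} {F : Args C m γ δ} :
      Γ.lookup x = .mk D T → (∀ j ∈ seqTyp Γ F D, S.Derivable j) →
      S.Derivable (.typ Γ (.var x F) (T.instSeq F))
  | var_eq {γ δ : Arity} {Γ : Ctx C m γ} {x : Var γ δ} {D : Tel C m γ δ}
      {T : Base C m (γ.append δ)} {F G : Args C m γ δ} :
      Γ.lookup x = .mk D T → (∀ j ∈ seqEq Γ F G D, S.Derivable j) →
      S.Derivable (.eq Γ (.var x F) (.var x G) (T.instSeq F))
  | ref {γ : Arity} {Γ : Ctx C m γ} {M : Obj C m γ} {T : Base C m γ} :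
      S.Derivable (.typ Γ M T) → S.Derivable (.eq Γ M M T)
  | sym {γ : Arity} {Γ : Ctx C m γ} {M N : Obj C m γ} {T : Base C m γ} :
      S.Derivable (.eq Γ M N T) → S.Derivable (.eq Γ N M T)
  | trans {γ : Arity} {Γ : Ctx C m γ} {M N P : Obj C m γ} {T : Base C m γ} :
      S.Derivable (.eq Γ M N T) → S.Derivable (.eq Γ N P T) → S.Derivable (.eq Γ M P T)
  | conv {γ : Arity} {Γ : Ctx C m γ} {M A B : Obj C m γ} :
      S.Derivable (.typ Γ M (.el A)) → S.Derivable (.eq Γ A B .type) →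
      S.Derivable (.typ Γ M (.el B))
  | conv_eq {γ : Arity} {Γ : Ctx C m γ} {M N A B : Obj C m γ} :
      S.Derivable (.eq Γ M N (.el A)) → S.Derivable (.eq Γ A B .type) →
      S.Derivable (.eq Γ M N (.el B))
  | const {γ δ : Arity} {Γ : Ctx C m γ} {c : C δ} {K : Kind C m Arity.nil δ}
      {D : Tel C m γ δ} {T : Base C m (γ.append δ)} {F : Args C m γ δ} :
      S.constKind c = some K → K.rename (Ren.empty γ) = .mk D T →
      (∀ j ∈ seqTyp Γ F D, S.Derivable j) →
      S.Derivable (.typ Γ (.const c F) (T.instSeq F))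
  | const_eq {γ δ : Arity} {Γ : Ctx C m γ} {c : C δ} {K : Kind C m Arity.nil δ}
      {D : Tel C m γ δ} {T : Base C m (γ.append δ)} {F G : Args C m γ δ} :
      S.constKind c = some K → K.rename (Ren.empty γ) = .mk D T →
      (∀ j ∈ seqEq Γ F G D, S.Derivable j) →
      S.Derivable (.eq Γ (.const c F) (.const c G) (T.instSeq F))
  | eq {γ : Arity} {Γ : Ctx C m γ} {E : EqDecl C m} {F : Args C m γ E.arity} :
      E ∈ S.eqns →
      (∀ j ∈ seqTyp Γ F (E.ctx.rename (Ren.empty γ)), S.Derivable j) →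
      S.Derivable (.eq Γ
        ((E.lhs.rename ((Ren.empty γ).lift _)).instSeq F)
        ((E.rhs.rename ((Ren.empty γ).lift _)).instSeq F)
        ((E.base.rename ((Ren.empty γ).lift _)).instSeq F))

/-- A defined judgement holds when all its primitive judgements are derivable. -/
def Spec.Holds (S : Spec C m) (J : Set (Jdg C m)) : Prop := ∀ j ∈ J, S.Derivable j

/-- `S` is `n`-good: in contexts of order at most `n`, both sides of a derivable equation
are typable with the kind at which they are equal. -/
def Spec.Good (S : Spec C m) (n : ℕ) : Prop :=
  ∀ {γ : Arity} (Γ : Ctx C m γ) (M N : Obj C m γ) (T : Base C m γ), γ.order ≤ n →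
    S.Derivable (.eq Γ M N T) → S.Derivable (.typ Γ M T) ∧ S.Derivable (.typ Γ N T)

end Judgements

section Erasure

variable {C : Arity → Type u}

/-! Erasure `|X|` of the kind labels on bound variables in abstractions.  (It is defined in
both modes, and changes nothing in the mode `curry`.) -/

mutual
def Obj.erase {m : Mode} {s : Arity} : Obj C m s → Obj C Mode.curry s
  | .var x F => .var x F.erase
  | .const c F => .const c F.erase

def Args.erase {m : Mode} {s α : Arity} : Args C m s α → Args C Mode.curry s α
  | .nil => .nil
  | .snoc F G => .snoc F.erase G.erase

def Abs.erase {m : Mode} {s α : Arity} : Abs C m s α → Abs C Mode.curry s α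
  | .plain M => .plain M.erase
  | .labelled _ M => .plain M.erase

def Tel.erase {m : Mode} {s α : Arity} : Tel C m s α → Tel C Mode.curry s α
  | .nil => .nil
  | .snoc D K => .snoc D.erase K.erase

def Kind.erase {m : Mode} {s α : Arity} : Kind C m s α → Kind C Mode.curry s α
  | .mk D T => .mk D.erase T.erase

def Base.erase {m : Mode} {s : Arity} : Base C m s → Base C Mode.curry s
  | .type => .type
  | .el A => .el A.erase
end

def Ctx.erase {m : Mode} {γ : Arity} : Ctx C m γ → Ctx C Mode.curry γ
  | .nil => .nil
  | .snoc Γ K => .snoc Γ.erase K.erase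

def EqDecl.erase {m : Mode} (E : EqDecl C m) : EqDecl C Mode.curry :=
  ⟨E.arity, E.ctx.erase, E.lhs.erase, E.rhs.erase, E.base.erase⟩

/-- The specification `|S|`. -/
def Spec.erase {m : Mode} (S : Spec C m) : Spec C Mode.curry where
  constKind c := (S.constKind c).map Kind.erase
  eqns := EqDecl.erase '' S.eqns

end Erasure

section Labelling

/-! The labelling `L` from `TF` to `TFk` relative to a specification `S` in `TF`.  Its
defining equations look up kinds of constants and variables, so that `L` is in general a
partial function; it is given by its graph, the least relation closed under the defining
equations, and shown to be single-valued below. -/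

variable {C : Arity → Type u}

mutual
/-- `LObj S Γ M M'`: `L_Γ(M)` is defined and is `M'`. -/
inductive LObj (S : Spec C Mode.curry) : {γ : Arity} → Ctx C Mode.curry γ →
    Obj C Mode.curry γ → Obj C Mode.church γ → Prop
  | const {γ α : Arity} {Γ : Ctx C Mode.curry γ} {c : C α} {K : Kind C Mode.curry Arity.nil α}
      {D : Tel C Mode.curry γ α} {T : Base C Mode.curry (γ.append α)}
      {F : Args C Mode.curry γ α} {F' : Args C Mode.church γ α} :
      S.constKind c = some K → K.rename (Ren.empty γ) = .mk D T →
      LSeq S Γ D F F' → LObj S Γ (.const c F) (.const c F')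
  | var {γ α : Arity} {Γ : Ctx C Mode.curry γ} {x : Var γ α}
      {D : Tel C Mode.curry γ α} {T : Base C Mode.curry (γ.append α)}
      {F : Args C Mode.curry γ α} {F' : Args C Mode.church γ α} :
      Γ.lookup x = .mk D T →
      LSeq S Γ D F F' → LObj S Γ (.var x F) (.var x F')

/-- `LAbs S Γ K F F'`: `L_Γ^K(F)` is defined and is `F'`. -/
inductive LAbs (S : Spec C Mode.curry) : {γ α : Arity} → Ctx C Mode.curry γ →
    Kind C Mode.curry γ α → Abs C Mode.curry γ α → Abs C Mode.church γ α → Prop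
  | mk {γ α : Arity} {Γ : Ctx C Mode.curry γ} {D : Tel C Mode.curry γ α}
      {T : Base C Mode.curry (γ.append α)} {M : Obj C Mode.curry (γ.append α)}
      {D' : Tel C Mode.church γ α} {M' : Obj C Mode.church (γ.append α)} :
      LTel S Γ D D' → LObj S (Γ.append D) M M' →
      LAbs S Γ (.mk D T) (.plain M) (.labelled D' M')

/-- `LSeq S Γ Δ F⃗ F⃗'`: `L_Γ^Δ(F⃗)` is defined and is `F⃗'`. -/
inductive LSeq (S : Spec C Mode.curry) : {γ α : Arity} → Ctx C Mode.curry γ →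
    Tel C Mode.curry γ α → Args C Mode.curry γ α → Args C Mode.church γ α → Prop
  | nil {γ : Arity} {Γ : Ctx C Mode.curry γ} : LSeq S Γ .nil .nil .nil
  | snoc {γ α β : Arity} {Γ : Ctx C Mode.curry γ} {D : Tel C Mode.curry γ α}
      {K : Kind C Mode.curry (γ.append α) β}
      {F : Args C Mode.curry γ α} {G : Abs C Mode.curry γ β}
      {F' : Args C Mode.church γ α} {G' : Abs C Mode.church γ β} :
      LSeq S Γ D F F' → LAbs S Γ (K.instSeq F) G G' →
      LSeq S Γ (.snoc D K) (.snoc F G) (.snoc F' G')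

/-- `LTel S Γ Δ Δ'`: `L_Γ(Δ)` is defined and is `Δ'`. -/
inductive LTel (S : Spec C Mode.curry) : {γ α : Arity} → Ctx C Mode.curry γ →
    Tel C Mode.curry γ α → Tel C Mode.church γ α → Prop
  | nil {γ : Arity} {Γ : Ctx C Mode.curry γ} : LTel S Γ .nil .nil
  | snoc {γ α β : Arity} {Γ : Ctx C Mode.curry γ} {D : Tel C Mode.curry γ α}
      {K : Kind C Mode.curry (γ.append α) β}
      {D' : Tel C Mode.church γ α} {K' : Kind C Mode.church (γ.append α) β} :
      LTel S Γ D D' → LKind S (Γ.append D) K K' →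
      LTel S Γ (.snoc D K) (.snoc D' K')

/-- `LKind S Γ K K'`: `L_Γ(K)` is defined and is `K'`. -/
inductive LKind (S : Spec C Mode.curry) : {γ α : Arity} → Ctx C Mode.curry γ →
    Kind C Mode.curry γ α → Kind C Mode.church γ α → Prop
  | type {γ α : Arity} {Γ : Ctx C Mode.curry γ} {D : Tel C Mode.curry γ α}
      {D' : Tel C Mode.church γ α} :
      LTel S Γ D D' → LKind S Γ (.mk D .type) (.mk D' .type)
  | el {γ α : Arity} {Γ : Ctx C Mode.curry γ} {D : Tel C Mode.curry γ α}
      {A : Obj C Mode.curry (γ.append α)}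
      {D' : Tel C Mode.church γ α} {A' : Obj C Mode.church (γ.append α)} :
      LTel S Γ D D' → LObj S (Γ.append D) A A' →
      LKind S Γ (.mk D (.el A)) (.mk D' (.el A'))
end

variable {S : Spec C Mode.curry}

mutual
theorem LObj.unique {γ : Arity} {Γ : Ctx C Mode.curry γ} {M : Obj C Mode.curry γ}
    {M₁ M₂ : Obj C Mode.church γ} : LObj S Γ M M₁ → LObj S Γ M M₂ → M₁ = M₂
  | .const h k a, .const h' k' a' => by
      obtain rfl := Option.some.inj (h.symm.trans h')
      obtain ⟨rfl, rfl⟩ := Kind.mk.inj (k.symm.trans k')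
      rw [a.unique a']
  | .var k a, .var k' a' => by
      obtain ⟨rfl, rfl⟩ := Kind.mk.inj (k.symm.trans k')
      rw [a.unique a']
termination_by structural h => h

theorem LAbs.unique {γ α : Arity} {Γ : Ctx C Mode.curry γ} {K : Kind C Mode.curry γ α}
    {F : Abs C Mode.curry γ α} {F₁ F₂ : Abs C Mode.church γ α} :
    LAbs S Γ K F F₁ → LAbs S Γ K F F₂ → F₁ = F₂
  | .mk a b, .mk a' b' => by rw [a.unique a', b.unique b']
termination_by structural h => h

theorem LSeq.unique {γ α : Arity} {Γ : Ctx C Mode.curry γ} {D : Tel C Mode.curry γ α}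
    {F : Args C Mode.curry γ α} {F₁ F₂ : Args C Mode.church γ α} :
    LSeq S Γ D F F₁ → LSeq S Γ D F F₂ → F₁ = F₂
  | .nil, .nil => rfl
  | .snoc a b, .snoc a' b' => by rw [a.unique a', b.unique b']
termination_by structural h => h

theorem LTel.unique {γ α : Arity} {Γ : Ctx C Mode.curry γ} {D : Tel C Mode.curry γ α}
    {D₁ D₂ : Tel C Mode.church γ α} : LTel S Γ D D₁ → LTel S Γ D D₂ → D₁ = D₂
  | .nil, .nil => rfl
  | .snoc a b, .snoc a' b' => by rw [a.unique a', b.unique b']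
termination_by structural h => h

theorem LKind.unique {γ α : Arity} {Γ : Ctx C Mode.curry γ} {K : Kind C Mode.curry γ α}
    {K₁ K₂ : Kind C Mode.church γ α} : LKind S Γ K K₁ → LKind S Γ K K₂ → K₁ = K₂
  | .type a, .type a' => by rw [a.unique a']
  | .el a b, .el a' b' => by rw [a.unique a', b.unique b']
termination_by structural h => h
end

end Labelling

end TF

-- The labelling reads the labels of an abstraction off the kind at which the abstraction is
-- checked. If `[Δ₁]M` has kind `(Δ)T`, the typing judgement contains `Δ = Δ₁` and `Γ, Δ ⊢ M : T`.
-- The recomputed label is the relabelling of `|Δ|`, so if relabelling does not change `Δ` up to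
-- derivable equality, then both the old label and the new one equal `Δ`. That is what equality of
-- labelled abstractions at `(Δ)T` asks of the labels. These equalities are then carried through
-- applications by `var_eq` and `const_eq`.
--
-- The proof is one induction on derivations, `Spec.Derivable.relabelled`. The invariant for `Γ ⊢ M
-- : T` speaks not only of `M` but also of every kind in `Γ`. Applied to the body `M` in `Γ, Δ`, it
-- therefore also yields the relabelling of `Δ` (`Ctx.Relabelled.exists_lTel`). The recursion
-- defining the labelling terminates because it follows the derivation.
--
-- Labelling a sequence uses the kinds `{|F⃗|/|Δ|}|K|`, whereas typing uses `{F⃗/Δ}K`. Erasing the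
-- latter gives the former (`Kind.erase_instSeq`), since labels never influence hereditary
-- substitution. The labels of an instantiated kind come from the typing of the next abstraction at
-- that kind, so it is never necessary to know how labelling interacts with substitution.

namespace TF

variable {C : Arity → Type u}

-- Erasure commutes with renaming

section ErasureLemmas

mutual
theorem Obj.erase_rename {m : Mode} {s t : Arity} : (M : Obj C m s) → (r : Ren s t) →
    (M.rename r).erase = M.erase.rename r
  | .var x F, r => by simp only [Obj.rename, Obj.erase, F.erase_rename r]
  | .const c F, r => by simp only [Obj.rename, Obj.erase, F.erase_rename r]
termination_by structural x => x

theorem Args.erase_rename {m : Mode} {s t α : Arity} : (F : Args C m s α) → (r : Ren s t) →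
    (F.rename r).erase = F.erase.rename r
  | .nil, _ => rfl
  | .snoc F G, r => by
      simp only [Args.rename, Args.erase, F.erase_rename r, G.erase_rename r]
termination_by structural x => x

theorem Abs.erase_rename {m : Mode} {s t α : Arity} : (F : Abs C m s α) → (r : Ren s t) →
    (F.rename r).erase = F.erase.rename r
  | .plain M, r => by simp only [Abs.rename, Abs.erase, M.erase_rename]
  | .labelled _ M, r => by simp only [Abs.rename, Abs.erase, M.erase_rename]
termination_by structural x => x

theorem Tel.erase_rename {m : Mode} {s t α : Arity} : (D : Tel C m s α) → (r : Ren s t) →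
    (D.rename r).erase = D.erase.rename r
  | .nil, _ => rfl
  | .snoc D K, r => by
      simp only [Tel.rename, Tel.erase, D.erase_rename r, K.erase_rename]
termination_by structural x => x

theorem Kind.erase_rename {m : Mode} {s t α : Arity} : (K : Kind C m s α) → (r : Ren s t) →
    (K.rename r).erase = K.erase.rename r
  | .mk D T, r => by
      simp only [Kind.rename, Kind.erase, D.erase_rename r, T.erase_rename]
termination_by structural x => x

theorem Base.erase_rename {m : Mode} {s t : Arity} : (T : Base C m s) → (r : Ren s t) →
    (T.rename r).erase = T.erase.rename r
  | .type, _ => rfl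
  | .el A, r => by simp only [Base.rename, Base.erase, A.erase_rename r]
end

-- Erasure commutes with hereditary instantiation and with context operations

theorem Abs.erase_body {m : Mode} {s α : Arity} (F : Abs C m s α) :
    F.body.erase = F.erase.body := by
  cases F <;> rfl

/-- The operation `e'` on `TF`-objects is the erasure of the operation `e`. -/
def Employ.ErasesTo {m : Mode} {α : Arity} (e : Employ C m α) (e' : Employ C Mode.curry α) :
    Prop :=
  ∀ ⦃s : Arity⦄ (F : Args C m s α) (M : Obj C m (s.append α)),
    (e F M).erase = e' F.erase M.erase

theorem Hit.erase_resolve {m : Mode} {α s β : Arity} {e : Employ C m α}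
    {e' : Employ C Mode.curry α} (he : e.ErasesTo e') (F : Abs C m s α) (h : Hit α s β)
    (G : Args C m s β) :
    (h.resolve e F G).erase = h.resolve e' F.erase G.erase := by
  cases h with
  | hit => simp only [Hit.resolve, he G F.body, Abs.erase_body]
  | miss y => simp only [Hit.resolve, Obj.erase]

mutual
-- Keeping `e` and `e'` arbitrary separates the structural recursion on expressions from the
-- recursion on arities, which is done in `employ_erasesTo`. Only the body of the instantiating
-- abstraction is ever used, so its label leaves no trace after erasure.
theorem Obj.erase_instWith {m : Mode} {α s' s : Arity} : (M : Obj C m s') →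
    (e : Employ C m α) → (e' : Employ C Mode.curry α) → e.ErasesTo e' →
    (i : Ins α s' s) → (F : Abs C m s α) →
    (M.instWith e i F).erase = M.erase.instWith e' i F.erase
  | .var z G, e, e', he, i, F => by
      simp only [Obj.instWith, Obj.erase, Hit.erase_resolve he,
        G.erase_instWith e e' he i F]
  | .const c G, e, e', he, i, F => by
      simp only [Obj.instWith, Obj.erase, G.erase_instWith e e' he i F]
termination_by structural x => x

theorem Args.erase_instWith {m : Mode} {α s' s β : Arity} : (G : Args C m s' β) →
    (e : Employ C m α) → (e' : Employ C Mode.curry α) → e.ErasesTo e' →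
    (i : Ins α s' s) → (F : Abs C m s α) →
    (G.instWith e i F).erase = G.erase.instWith e' i F.erase
  | .nil, _, _, _, _, _ => rfl
  | .snoc G H, e, e', he, i, F => by
      simp only [Args.instWith, Args.erase, G.erase_instWith e e' he i F,
        H.erase_instWith e e' he i F]
termination_by structural x => x

theorem Abs.erase_instWith {m : Mode} {α s' s β : Arity} : (G : Abs C m s' β) →
    (e : Employ C m α) → (e' : Employ C Mode.curry α) → e.ErasesTo e' →
    (i : Ins α s' s) → (F : Abs C m s α) →
    (G.instWith e i F).erase = G.erase.instWith e' i F.erase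
  | .plain M, e, e', he, i, F => by
      simp only [Abs.instWith, Abs.erase, M.erase_instWith e e' he, Abs.erase_rename]
  | .labelled _ M, e, e', he, i, F => by
      simp only [Abs.instWith, Abs.erase, M.erase_instWith e e' he, Abs.erase_rename]
termination_by structural x => x

theorem Tel.erase_instWith {m : Mode} {α s' s β : Arity} : (D : Tel C m s' β) →
    (e : Employ C m α) → (e' : Employ C Mode.curry α) → e.ErasesTo e' →
    (i : Ins α s' s) → (F : Abs C m s α) →
    (D.instWith e i F).erase = D.erase.instWith e' i F.erase
  | .nil, _, _, _, _, _ => rfl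
  | .snoc D K, e, e', he, i, F => by
      simp only [Tel.instWith, Tel.erase, D.erase_instWith e e' he i F,
        K.erase_instWith e e' he, Abs.erase_rename]
termination_by structural x => x

theorem Kind.erase_instWith {m : Mode} {α s' s β : Arity} : (K : Kind C m s' β) →
    (e : Employ C m α) → (e' : Employ C Mode.curry α) → e.ErasesTo e' →
    (i : Ins α s' s) → (F : Abs C m s α) →
    (K.instWith e i F).erase = K.erase.instWith e' i F.erase
  | .mk D T, e, e', he, i, F => by
      simp only [Kind.instWith, Kind.erase, D.erase_instWith e e' he i F,
        T.erase_instWith e e' he, Abs.erase_rename]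
termination_by structural x => x

theorem Base.erase_instWith {m : Mode} {α s' s : Arity} : (T : Base C m s') →
    (e : Employ C m α) → (e' : Employ C Mode.curry α) → e.ErasesTo e' →
    (i : Ins α s' s) → (F : Abs C m s α) →
    (T.instWith e i F).erase = T.erase.instWith e' i F.erase
  | .type, _, _, _, _, _ => rfl
  | .el A, e, e', he, i, F => by
      simp only [Base.instWith, Base.erase, A.erase_instWith e e' he i F]
end

/-- Induction on the arity: unfolding `employ (α.snoc β)` uses `employ` only at the smaller arities
`α` and `β`. -/
theorem employ_erasesTo {m : Mode} : (α : Arity) →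
    (employ (C := C) (m := m) α).ErasesTo (employ α)
  | .nil => fun _ _ _ => rfl
  | .snoc α β => fun s Fs M => by
      cases Fs with
      | snoc Fs F =>
        simp only [employ, Args.erase]
        rw [employ_erasesTo α Fs, Obj.erase_instWith M _ _ (employ_erasesTo β),
          Abs.erase_rename]

theorem Kind.erase_instSeq {m : Mode} {s α β : Arity} : (F : Args C m s α) →
    (K : Kind C m (s.append α) β) → (K.instSeq F).erase = K.erase.instSeq F.erase
  | .nil, _ => rfl
  | .snoc F G, K => by
      simp only [Kind.instSeq, Args.erase, Kind.inst]
      rw [Kind.erase_instSeq F, Kind.erase_instWith K _ _ (employ_erasesTo _),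
        Abs.erase_rename]

theorem Ctx.erase_append {m : Mode} {γ δ : Arity} (Γ : Ctx C m γ) : (D : Tel C m γ δ) →
    (Γ.append D).erase = Γ.erase.append D.erase
  | .nil => rfl
  | .snoc D K => by simp only [Ctx.append, Ctx.erase, Tel.erase, Ctx.erase_append Γ D]

theorem Ctx.erase_lookup {m : Mode} {γ α : Arity} : (Γ : Ctx C m γ) → (x : Var γ α) →
    (Γ.lookup x).erase = Γ.erase.lookup x
  | .snoc Γ K, .zero => by simp only [Ctx.lookup, Ctx.erase, Kind.erase_rename]
  | .snoc Γ K, .succ x => by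
      simp only [Ctx.lookup, Ctx.erase, Kind.erase_rename, Ctx.erase_lookup Γ x]

end ErasureLemmas

-- Relabelling along derivations

section Labelling

variable (S : Spec C Mode.church)

/-- `Γ` is valid, and the labelling of each of its kinds is defined and equal to that kind. -/
def Ctx.Relabelled {γ : Arity} : Ctx C Mode.church γ → Prop
  | .nil => S.Derivable (.valid .nil)
  | .snoc Γ K => S.Derivable (.valid (.snoc Γ K)) ∧ Ctx.Relabelled Γ ∧
      ∃ K', LKind S.erase Γ.erase K.erase K' ∧ S.Holds (eqKind K Γ K')

/-- `Γ` is relabelled, and the labelling of `M` is defined and equal to `M` as an object of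
kind `T`. -/
def Obj.Relabelled {γ : Arity} (Γ : Ctx C Mode.church γ) (M : Obj C Mode.church γ)
    (T : Base C Mode.church γ) : Prop :=
  Γ.Relabelled S ∧ ∃ M', LObj S.erase Γ.erase M.erase M' ∧ S.Derivable (.eq Γ M M' T)

/-- The property of a judgement established by induction on derivations. -/
def Jdg.Relabelled : Jdg C Mode.church → Prop
  | .valid Γ => Γ.Relabelled S
  | .typ Γ M T => M.Relabelled S Γ T
  | .eq _ _ _ _ => True
  | .undef => True

variable {S}

theorem Ctx.Relabelled.valid {γ : Arity} {Γ : Ctx C Mode.church γ} (h : Γ.Relabelled S) :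
    S.Derivable (.valid Γ) := by
  cases Γ with
  | nil => exact h
  | snoc Γ K => exact h.1

theorem Ctx.Relabelled.of_append {γ δ : Arity} {Γ : Ctx C Mode.church γ} :
    (D : Tel C Mode.church γ δ) → (Γ.append D).Relabelled S → Γ.Relabelled S
  | .nil, h => h
  | .snoc D _, h => of_append D h.2.1

/-- Collects the relabelled kinds stored in the invariant for `Γ, Δ`. This is the source of every
label that the labelling inserts. -/
theorem Ctx.Relabelled.exists_lTel {γ δ : Arity} {Γ : Ctx C Mode.church γ} :
    (D : Tel C Mode.church γ δ) → (Γ.append D).Relabelled S →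
    ∃ D', LTel S.erase Γ.erase D.erase D' ∧ S.Holds (eqTel D Γ D')
  | .nil, h => ⟨.nil, .nil, fun _ hj => by
      simp only [eqTel] at hj
      rcases hj with rfl
      exact h.valid⟩
  | .snoc D K, h => by
      obtain ⟨D', hD, hD'⟩ := exists_lTel D h.2.1
      obtain ⟨K', hK, hK'⟩ := h.2.2
      rw [Ctx.erase_append] at hK
      refine ⟨.snoc D' K', .snoc hD hK, fun j hj => ?_⟩
      simp only [eqTel] at hj
      exact hj.elim (hD' j) (hK' j)

theorem Ctx.Relabelled.of_isKind {γ α : Arity} {Γ : Ctx C Mode.church γ}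
    {K : Kind C Mode.church γ α} (h : ∀ j ∈ isKind Γ K, j.Relabelled S) :
    Γ.Relabelled S ∧ ∃ K', LKind S.erase Γ.erase K.erase K' ∧ S.Holds (eqKind K Γ K') := by
  obtain ⟨D, T⟩ := K
  cases T with
  | type =>
    have hv : (Γ.append D).Relabelled S := h _ rfl
    obtain ⟨D', hD, hD'⟩ := hv.exists_lTel D
    refine ⟨hv.of_append D, .mk D' .type, .type hD, fun j hj => ?_⟩
    simp only [eqKind, eqBase] at hj
    rcases hj with hj | rfl
    · exact hD' j hj
    · exact hv.valid
  | el A =>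
    obtain ⟨hv, A', hA, hA'⟩ : A.Relabelled S (Γ.append D) .type := h _ rfl
    obtain ⟨D', hD, hD'⟩ := hv.exists_lTel D
    rw [Ctx.erase_append] at hA
    refine ⟨hv.of_append D, .mk D' (.el A'), .el hD hA, fun j hj => ?_⟩
    simp only [eqKind, eqBase] at hj
    rcases hj with hj | rfl
    · exact hD' j hj
    · exact hA'

/-- The central step: the invariant for the body, taken in `Γ, Δ`, supplies both the relabelled body
and, through its context, the new label. -/
theorem Abs.exists_lAbs {γ α : Arity} {Γ : Ctx C Mode.church γ} (F : Abs C Mode.church γ α)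
    (K : Kind C Mode.church γ α) (hd : S.Holds (absTyp Γ F K))
    (h : ∀ j ∈ absTyp Γ F K, j.Relabelled S) :
    ∃ F', LAbs S.erase Γ.erase K.erase F.erase F' ∧ S.Holds (absEq Γ F F' K) := by
  obtain ⟨D, T⟩ := K
  cases F with
  | labelled D₁ M =>
    obtain ⟨hv, M', hM, hM'⟩ : M.Relabelled S (Γ.append D) T := h _ (Or.inr rfl)
    obtain ⟨D', hD, hD'⟩ := hv.exists_lTel D
    rw [Ctx.erase_append] at hM
    refine ⟨.labelled D' M', .mk hD hM, ?_⟩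
    -- The old label equals `D` by the typing of `F`, the new label equals `D` by relabelling of the
    -- context, and the bodies are equal by the invariant.
    rintro j ((hj | hj) | rfl)
    · exact hd j (Or.inl hj)
    · exact hD' j hj
    · exact hM'

theorem Args.exists_lSeq {γ δ : Arity} {Γ : Ctx C Mode.church γ} :
    (F : Args C Mode.church γ δ) → (D : Tel C Mode.church γ δ) →
    S.Holds (seqTyp Γ F D) → (∀ j ∈ seqTyp Γ F D, j.Relabelled S) →
    Γ.Relabelled S ∧
      ∃ F', LSeq S.erase Γ.erase D.erase F.erase F' ∧ S.Holds (seqEq Γ F F' D)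
  -- Typing the empty sequence is `Γ valid`; this is where the relabelling of the context enters the
  -- invariant for objects.
  | .nil, .nil, hd, h => ⟨h _ rfl, .nil, .nil, hd⟩
  | .snoc F G, .snoc D K, hd, h => by
      obtain ⟨hv, F', hF, hF'⟩ := exists_lSeq F D (fun j hj => hd j (Or.inl hj))
        (fun j hj => h j (Or.inl hj))
      obtain ⟨G', hG, hG'⟩ := G.exists_lAbs (K.instSeq F) (fun j hj => hd j (Or.inr hj))
        (fun j hj => h j (Or.inr hj))
      -- The kind is instantiated by the original `F`, both in the labelling (after erasure) and in
      -- `seqEq`, whose kinds use its left-hand sequence. No change of kind is needed.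
      rw [Kind.erase_instSeq] at hG
      exact ⟨hv, .snoc F' G', .snoc hF hG, fun j hj => hj.elim (hF' j) (hG' j)⟩

/-- Nothing has to be proved for equality judgements: a typing rule uses such a premise only as a
derivable fact, never through its relabelling. -/
theorem Spec.Derivable.relabelled {j : Jdg C Mode.church} (h : S.Derivable j) :
    j.Relabelled S := by
  induction h with
  | emp_ctxt => exact .emp_ctxt
  | ctxt h ih => exact ⟨.ctxt h, Ctx.Relabelled.of_isKind ih⟩
  | @var _ _ Γ x D T F hx h ih =>
    obtain ⟨hv, F', hF, hF'⟩ := F.exists_lSeq D h ih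
    refine ⟨hv, .var x F', .var (T := T.erase) ?_ hF, .var_eq hx hF'⟩
    -- The labelling looks the variable up in `|Γ|` and finds `(|D|)|T|`, so it labels the arguments
    -- against `|D|`.
    rw [← Ctx.erase_lookup, hx, Kind.erase]
  | @const _ _ Γ c K D T F hc hK h ih =>
    obtain ⟨hv, F', hF, hF'⟩ := F.exists_lSeq D h ih
    refine ⟨hv, .const c F', .const (K := K.erase) (T := T.erase) ?_ ?_ hF,
      .const_eq hc hK hF'⟩
    · simp only [Spec.erase, hc, Option.map_some]
    · rw [← Kind.erase_rename, hK, Kind.erase]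
  -- The labelling of an object does not depend on its kind, so the same `M'` serves at the new
  -- kind.
  | conv _ hAB ih _ =>
    obtain ⟨hv, M', hM, hM'⟩ := ih
    exact ⟨hv, M', hM, .conv_eq hM' hAB⟩
  -- The remaining rules all conclude an equality.
  | _ => trivial

theorem Spec.Holds.relabelled {J : Set (Jdg C Mode.church)} (h : S.Holds J) :
    ∀ j ∈ J, j.Relabelled S :=
  fun j hj => (h j hj).relabelled

end Labelling

end TF

-- The five assertions, read off from the invariant

theorem mainTheorem12 {C : TF.Arity → Type u} (S : TF.Spec C TF.Mode.church) (n : ℕ)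
    (hS : S.Good n) {γ : TF.Arity} (Γ : TF.Ctx C TF.Mode.church γ) (hΓ : γ.order ≤ n) :
    (∀ (M : TF.Obj C TF.Mode.church γ) (T : TF.Base C TF.Mode.church γ),
      S.Derivable (.typ Γ M T) →
      ∃ M', TF.LObj S.erase Γ.erase M.erase M' ∧ S.Derivable (.eq Γ M M' T)) ∧
    (∀ {α : TF.Arity} (F : TF.Abs C TF.Mode.church γ α) (K : TF.Kind C TF.Mode.church γ α),
      α.order ≤ n → S.Holds (TF.absTyp Γ F K) →
      ∃ F', TF.LAbs S.erase Γ.erase K.erase F.erase F' ∧ S.Holds (TF.absEq Γ F F' K)) ∧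
    (∀ {δ : TF.Arity} (F : TF.Args C TF.Mode.church γ δ) (D : TF.Tel C TF.Mode.church γ δ),
      δ.order ≤ n → S.Holds (TF.seqTyp Γ F D) →
      ∃ F', TF.LSeq S.erase Γ.erase D.erase F.erase F' ∧ S.Holds (TF.seqEq Γ F F' D)) ∧
    (∀ {α : TF.Arity} (K : TF.Kind C TF.Mode.church γ α),
      α.order ≤ n → S.Holds (TF.isKind Γ K) →
      ∃ K', TF.LKind S.erase Γ.erase K.erase K' ∧ S.Holds (TF.eqKind K Γ K')) ∧
    (∀ {δ : TF.Arity} (D : TF.Tel C TF.Mode.church γ δ),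
      δ.order ≤ n → S.Derivable (.valid (Γ.append D)) →
      ∃ D', TF.LTel S.erase Γ.erase D.erase D' ∧ S.Holds (TF.eqTel D Γ D')) := by
  refine ⟨fun M T h => h.relabelled.2, fun F K _ h => F.exists_lAbs K h h.relabelled,
    fun F D _ h => (F.exists_lSeq D h h.relabelled).2,
    fun K _ h => (TF.Ctx.Relabelled.of_isKind h.relabelled).2, fun D _ h => ?_⟩
  exact TF.Ctx.Relabelled.exists_lTel D h.relabelled
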